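/- Let $0<q<1$ and let $A$ be the symmetric operator on the complex Hilbert space $\ell^2(\mathbb{Z})$, with standard basis $(e_n)_{n\in\mathbb{Z}}$, whose domain is $\operatorname{span}\{e_n \mid n\in\mathbb{Z}\}$ and which acts by \[ A e_n = q^{-n+1}e_{n-1}+q^{-n}e_{n+1},\qquad n\in\mathbb{Z}. \] Then for every self-adjoint extension $A_t$ of $A$, \[ \operatorname{spec}_{ess}(A_t)=\operatorname{spec}_{c}(A_t)=\{0\}, \] and $0$ is not an eigenvalue of $A_t$. Here $\operatorname{spec}_{ess}(A_t)$ is the set of all points of the spectrum that are not isolated eigenvalues of finite multiplicity, and $\operatorname{spec}_{c}(A_t)$ is the set of all points $\lambda$ of the spectrum such that $A_t-\lambda$ is injective with dense range. -/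

import Mathlib

noncomputable section

namespace UnboundedOperator

variable {H : Type*} [NormedAddCommGroup H] [InnerProductSpace ℂ H]

/-- The resolvent set of a partially defined operator `T`: all `z` for which `T - z`, as a map from
the domain of `T` to the whole space, has an everywhere defined bounded two-sided inverse. -/
def resolventSet (T : H →ₗ.[ℂ] H) : Set ℂ :=
  {z | ∃ R : H →L[ℂ] H,
    (∀ y : H, ∃ hy : R y ∈ T.domain, T ⟨R y, hy⟩ - z • R y = y) ∧
    ∀ x : T.domain, R (T x - z • (x : H)) = (x : H)}

/-- The spectrum of `T`. -/
def spec (T : H →ₗ.[ℂ] H) : Set ℂ := (resolventSet T)ᶜ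

/-- The kernel of `T - z`, as a subspace of the ambient space. -/
def eigenspace (T : H →ₗ.[ℂ] H) (z : ℂ) : Submodule ℂ H :=
  (LinearMap.ker (T.toFun - z • T.domain.subtype)).map T.domain.subtype

/-- The point spectrum of `T`: the set of its eigenvalues. -/
def pointSpec (T : H →ₗ.[ℂ] H) : Set ℂ := {z | eigenspace T z ≠ ⊥}

/-- The continuous spectrum of `T`: the points `z` of the spectrum for which `T - z` is injective
and has dense range. -/
def contSpec (T : H →ₗ.[ℂ] H) : Set ℂ :=
  {z | z ∈ spec T ∧ eigenspace T z = ⊥ ∧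
    Dense (Set.range fun x : T.domain => T x - z • (x : H))}

/-- The discrete spectrum of a self-adjoint operator `T`: the isolated points of the spectrum that
are eigenvalues of finite multiplicity. -/
def discreteSpec (T : H →ₗ.[ℂ] H) : Set ℂ :=
  {z | z ∈ pointSpec T ∧ FiniteDimensional ℂ (eigenspace T z) ∧
    ∃ ε : ℝ, 0 < ε ∧ ∀ w ∈ spec T, dist w z < ε → w = z}

/-- The essential spectrum of a self-adjoint operator `T`: the complement of the discrete spectrum
in the spectrum. -/
def essSpec (T : H →ₗ.[ℂ] H) : Set ℂ := spec T \ discreteSpec T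

theorem mem_eigenspace_iff (T : H →ₗ.[ℂ] H) (z : ℂ) (x : H) :
    x ∈ eigenspace T z ↔ ∃ hx : x ∈ T.domain, T ⟨x, hx⟩ = z • x := by
  simp only [eigenspace, Submodule.mem_map, LinearMap.mem_ker, LinearMap.sub_apply,
    LinearMap.smul_apply, Submodule.subtype_apply, sub_eq_zero]
  constructor
  · rintro ⟨y, hy, rfl⟩
    exact ⟨y.2, hy⟩
  · rintro ⟨hx, h⟩
    exact ⟨⟨x, hx⟩, h, rfl⟩

end UnboundedOperator

namespace JacobiA

/-- The complex Hilbert space `ℓ²(ℤ)`. -/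
abbrev L2Z : Type := lp (fun _ : ℤ => ℂ) 2

/-- The standard basis vector `e n` of `ℓ²(ℤ)`. -/
def e (n : ℤ) : L2Z := lp.single 2 n (1 : ℂ)

theorem e_apply (n m : ℤ) : (e n : ℤ → ℂ) m = if m = n then 1 else 0 := by
  simp [e, Pi.single_apply]

theorem linearIndependent_e : LinearIndependent ℂ e := by
  rw [linearIndependent_iff']
  intro s g hg i hi
  have h := congrArg (fun f : L2Z => (f : ℤ → ℂ) i) hg
  simp only [lp.coeFn_sum, Finset.sum_apply, lp.coeFn_smul, Pi.smul_apply, e_apply] at h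
  simpa [hi] using h

/-- The operator `A = A(q)` with domain `span {e n | n ∈ ℤ}`, determined by linearity from
`A e n = q^(-n+1) e (n-1) + q^(-n) e (n+1)`. -/
def A (q : ℝ) : L2Z →ₗ.[ℂ] L2Z where
  domain := Submodule.span ℂ (Set.range e)
  toFun := (Module.Basis.span linearIndependent_e).constr ℂ fun n : ℤ =>
    ((q : ℂ) ^ (-n + 1)) • e (n - 1) + ((q : ℂ) ^ (-n)) • e (n + 1)

theorem e_mem_domain (q : ℝ) (n : ℤ) : e n ∈ (A q).domain :=
  Submodule.subset_span ⟨n, rfl⟩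

theorem A_apply_e (q : ℝ) (n : ℤ) :
    A q ⟨e n, e_mem_domain q n⟩ =
      ((q : ℂ) ^ (-n + 1)) • e (n - 1) + ((q : ℂ) ^ (-n)) • e (n + 1) := by
  have h : (⟨e n, e_mem_domain q n⟩ : (A q).domain) =
      Module.Basis.span linearIndependent_e n :=
    (Module.Basis.span_apply linearIndependent_e n).symm
  rw [h]
  exact (Module.Basis.span linearIndependent_e).constr_basis ℂ _ n

end JacobiA

end

/-!
Let `U` be the bilateral shift and `T` a self-adjoint extension of `A`. Multiplying the `n`-th
coordinate of `T x` by `q ^ n` gives the `n`-th coordinate of `B x`, where `B = U + q U⁻¹` is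
bounded with `(1 - |q|) ‖x‖ ≤ ‖B x‖`. Hence `T` is injective, while `T e₋ₖ → 0` puts `0` in the
spectrum; as `0` is not an eigenvalue, it lies in the continuous spectrum.

For `z ≠ 0` let `K x` have the coordinates of `B x` for `n ≥ 0` and those of `T x` for `n < 0`. Then
the `n`-th coordinate of `K x` is at most `|q| ^ |n| * max ‖B x‖ ‖T x‖`, so `K` maps sets that are
bounded in the graph norm of `T` into compact Hilbert cubes. In the coordinates `n ≤ 0` one has
`z x = K x - (T - z) x`, and these coordinates of `x` together with `K x` control `B x`, hence `x`.
This gives `‖x‖ ≤ C (‖K x‖ + ‖(T - z) x‖)`, which rules out singular Weyl sequences at `z`; a point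
of the spectrum around which there are none is an isolated eigenvalue of finite multiplicity.
-/

noncomputable section

open Filter Topology
open scoped ENNReal NNReal

namespace UnboundedOperator

theorem cauchySeq_of_antilipschitzWith {X Y : Type*} [PseudoMetricSpace X] [PseudoMetricSpace Y]
    {f : X → Y} {C : ℝ≥0} (hf : AntilipschitzWith C f) {x : ℕ → X}
    (hx : CauchySeq fun k => f (x k)) : CauchySeq x := by
  rw [cauchySeq_iff_tendsto] at hx ⊢
  have hcomap : Tendsto (Prod.map x x) atTop (comap (Prod.map f f) (uniformity Y)) :=
    tendsto_comap_iff.2 hx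
  exact hcomap.mono_right hf.comap_uniformity_le

variable {H : Type*} [NormedAddCommGroup H] [InnerProductSpace ℂ H] {T : H →ₗ.[ℂ] H} {z : ℂ}

/-- The linear map `T - z`, defined on the domain of `T`. -/
def subScalar (T : H →ₗ.[ℂ] H) (z : ℂ) : T.domain →ₗ[ℂ] H := T.toFun - z • T.domain.subtype

theorem subScalar_apply (x : T.domain) : subScalar T z x = T x - z • (x : H) := rfl

theorem subScalar_eq_zero_iff {x : T.domain} : subScalar T z x = 0 ↔ T x = z • (x : H) :=
  sub_eq_zero

theorem mem_pointSpec_iff : z ∈ pointSpec T ↔ ∃ x : T.domain, x ≠ 0 ∧ subScalar T z x = 0 := by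
  simp only [pointSpec, Set.mem_ofPred_eq, Submodule.ne_bot_iff, mem_eigenspace_iff]
  constructor
  · rintro ⟨x, ⟨hx, hTx⟩, hx0⟩
    exact ⟨⟨x, hx⟩, fun h => hx0 (congrArg Subtype.val h), subScalar_eq_zero_iff.2 hTx⟩
  · rintro ⟨x, hx0, hx⟩
    exact ⟨x, ⟨x.2, subScalar_eq_zero_iff.1 hx⟩, fun h => hx0 (Subtype.ext h)⟩

theorem exists_unit_eigenvector (hz : z ∈ pointSpec T) :
    ∃ x : T.domain, ‖x‖ = 1 ∧ subScalar T z x = 0 := by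
  obtain ⟨x, hx0, hx⟩ := mem_pointSpec_iff.1 hz
  exact ⟨(‖x‖⁻¹ : ℂ) • x, norm_smul_inv_norm hx0, by rw [map_smul, hx, smul_zero]⟩

theorem mem_spec_of_tendsto_zero {x : ℕ → T.domain} (hx : ∀ k, ‖x k‖ = 1)
    (hlim : Tendsto (fun k => subScalar T z (x k)) atTop (𝓝 0)) : z ∈ spec T := by
  rintro ⟨R, -, hR⟩
  have hRx : Tendsto (fun k => (x k : H)) atTop (𝓝 0) := by
    simpa only [Function.comp_def, subScalar_apply, hR, map_zero]
      using (R.continuous.tendsto 0).comp hlim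
  have hnorm : Tendsto (fun k => ‖x k‖) atTop (𝓝 ‖(0 : H)‖) := hRx.norm
  simp only [hx, norm_zero, tendsto_const_nhds_iff, one_ne_zero] at hnorm

theorem contSpec_subset_essSpec (T : H →ₗ.[ℂ] H) : contSpec T ⊆ essSpec T :=
  fun _ hz => ⟨hz.1, fun hdisc => hdisc.1 hz.2.1⟩

theorem exists_subScalar_eq_of_tendsto (hT : T.IsClosed) {x : ℕ → T.domain} {a b : H}
    (ha : Tendsto (fun k => (x k : H)) atTop (𝓝 a))
    (hb : Tendsto (fun k => subScalar T z (x k)) atTop (𝓝 b)) :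
    ∃ y : T.domain, (y : H) = a ∧ subScalar T z y = b := by
  have hTx : Tendsto (fun k => T (x k)) atTop (𝓝 (b + z • a)) := by
    simpa only [subScalar_apply, sub_add_cancel] using hb.add (ha.const_smul z)
  have hmem : (a, b + z • a) ∈ (T.graph : Set (H × H)) :=
    hT.mem_of_tendsto (ha.prodMk_nhds hTx) (Eventually.of_forall fun k => T.mem_graph (x k))
  obtain ⟨y, hya, hTy⟩ := T.mem_graph_iff.1 hmem
  exact ⟨y, hya, by rw [subScalar_apply, hTy, hya, add_sub_cancel_right]⟩

theorem isClosed_range_subScalar [CompleteSpace H] (hT : T.IsClosed) {C : ℝ≥0}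
    (hC : AntilipschitzWith C (subScalar T z)) :
    IsClosed (LinearMap.range (subScalar T z) : Set H) := by
  refine IsSeqClosed.isClosed fun y b hy hb => ?_
  choose x hx using hy
  obtain rfl : (fun k => subScalar T z (x k)) = y := funext hx
  have hcauchy := cauchySeq_of_antilipschitzWith hC hb.cauchySeq
  obtain ⟨a, ha⟩ := cauchySeq_tendsto_of_complete (u := fun k => (x k : H))
    (hcauchy.map uniformContinuous_subtype_val)
  obtain ⟨c, -, hc⟩ := exists_subScalar_eq_of_tendsto hT ha hb
  exact ⟨c, hc⟩

/-- `T - z` is proper on the unit ball: there is no singular Weyl sequence for `T` at `z`, that is,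
every sequence in the unit ball which `T - z` maps to a null sequence has a convergent subsequence.
For self-adjoint `T` this means that `z` is not in the essential spectrum. -/
def IsProperAt (T : H →ₗ.[ℂ] H) (z : ℂ) : Prop :=
  ∀ x : ℕ → T.domain, (∀ k, ‖x k‖ ≤ 1) → Tendsto (fun k => subScalar T z (x k)) atTop (𝓝 0) →
    ∃ (a : H) (φ : ℕ → ℕ), StrictMono φ ∧ Tendsto (fun k => (x (φ k) : H)) atTop (𝓝 a)

/-- `K` is compact relative to `T`: it maps sets which are bounded in the graph norm of `T` into
compact sets. -/
def IsRelativelyCompact {E : Type*} [NormedAddCommGroup E] [NormedSpace ℂ E] (T : H →ₗ.[ℂ] H)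
    (K : T.domain →ₗ[ℂ] E) : Prop :=
  ∀ M : ℝ, ∃ S : Set E, IsCompact S ∧ ∀ x : T.domain, ‖x‖ ≤ M → ‖T x‖ ≤ M → K x ∈ S

/-- Peetre's lemma. -/
theorem isProperAt_of_antilipschitzWith_prod [CompleteSpace H] {E : Type*} [NormedAddCommGroup E]
    [NormedSpace ℂ E] {K : T.domain →ₗ[ℂ] E} (hK : IsRelativelyCompact T K) {C : ℝ≥0}
    (hC : AntilipschitzWith C (K.prod (subScalar T z))) : IsProperAt T z := by
  intro x hx hlim
  obtain ⟨M, hM⟩ := (Metric.isBounded_range_of_tendsto _ hlim).exists_norm_le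
  have hTx : ∀ k, ‖T (x k)‖ ≤ M + ‖z‖ := fun k => calc
    ‖T (x k)‖ = ‖subScalar T z (x k) + z • (x k : H)‖ := by rw [subScalar_apply, sub_add_cancel]
    _ ≤ ‖subScalar T z (x k)‖ + ‖z‖ * ‖x k‖ := (norm_add_le _ _).trans_eq (by rw [norm_smul]; rfl)
    _ ≤ M + ‖z‖ :=
      add_le_add (hM _ ⟨k, rfl⟩) (mul_le_of_le_one_right (norm_nonneg z) (hx k))
  obtain ⟨S, hS, hKS⟩ := hK (max 1 (M + ‖z‖))
  obtain ⟨b, -, φ, hφ, hb⟩ := hS.tendsto_subseq fun k =>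
    hKS (x k) (le_max_of_le_left (hx k)) (le_max_of_le_right (hTx k))
  have hcauchy : CauchySeq fun k => x (φ k) :=
    cauchySeq_of_antilipschitzWith hC (hb.prodMk_nhds (hlim.comp hφ.tendsto_atTop)).cauchySeq
  obtain ⟨a, ha⟩ := cauchySeq_tendsto_of_complete (u := fun k => (x (φ k) : H))
    (hcauchy.map uniformContinuous_subtype_val)
  exact ⟨a, φ, hφ, ha⟩

namespace IsProperAt

theorem exists_tendsto_ker (hp : IsProperAt T z) (hT : T.IsClosed) {x : ℕ → T.domain}
    (hx : ∀ k, ‖x k‖ ≤ 1) (hlim : Tendsto (fun k => subScalar T z (x k)) atTop (𝓝 0)) :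
    ∃ a : T.domain, subScalar T z a = 0 ∧
      ∃ φ : ℕ → ℕ, StrictMono φ ∧ Tendsto (fun k => x (φ k)) atTop (𝓝 a) := by
  obtain ⟨a, φ, hφ, ha⟩ := hp x hx hlim
  obtain ⟨y, rfl, hy⟩ := exists_subScalar_eq_of_tendsto hT ha (hlim.comp hφ.tendsto_atTop)
  exact ⟨y, hy, φ, hφ, tendsto_subtype_rng.2 ha⟩

theorem exists_antilipschitzWith (hp : IsProperAt T z) (hT : T.IsClosed) (hz : z ∉ pointSpec T) :
    ∃ C : ℝ≥0, AntilipschitzWith C (subScalar T z) := by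
  by_contra! hcon
  have happrox : ∀ k : ℕ, ∃ u : T.domain, ‖u‖ = 1 ∧ ‖subScalar T z u‖ ≤ 1 / ((k : ℝ) + 1) := by
    intro k
    obtain ⟨x, hx⟩ : ∃ x : T.domain, ((k : ℝ) + 1) * ‖subScalar T z x‖ < ‖x‖ := by
      by_contra! hbound
      exact hcon (k + 1) (AddMonoidHomClass.antilipschitz_of_bound _ (by exact_mod_cast hbound))
    have hxpos : 0 < ‖x‖ := lt_of_le_of_lt (by positivity) hx
    refine ⟨(‖x‖⁻¹ : ℂ) • x, norm_smul_inv_norm (norm_pos_iff.1 hxpos), ?_⟩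
    rw [map_smul, norm_smul, norm_inv, Complex.norm_real, norm_norm, inv_mul_le_iff₀ hxpos,
      mul_one_div, le_div_iff₀' (by positivity)]
    exact hx.le
  choose u hu hSu using happrox
  obtain ⟨a, ha, φ, -, hφ⟩ := hp.exists_tendsto_ker hT (fun k => (hu k).le)
    (squeeze_zero_norm hSu tendsto_one_div_add_atTop_nhds_zero_nat)
  have hnorm : ‖a‖ = 1 := tendsto_nhds_unique hφ.norm (by simp only [hu, tendsto_const_nhds])
  exact hz (mem_pointSpec_iff.2 ⟨a, norm_ne_zero_iff.1 (hnorm ▸ one_ne_zero), ha⟩)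

theorem finiteDimensional_eigenspace (hp : IsProperAt T z) (hT : T.IsClosed) :
    FiniteDimensional ℂ (eigenspace T z) := by
  suffices hker : FiniteDimensional ℂ (LinearMap.ker (subScalar T z)) from
    Module.Finite.map (LinearMap.ker (subScalar T z)) T.domain.subtype
  refine FiniteDimensional.of_isCompact_closedBall₀ ℂ one_pos (IsSeqCompact.isCompact ?_)
  intro u hu
  have hu1 : ∀ k, ‖(u k : T.domain)‖ ≤ 1 := fun k => by simpa using hu k
  have hSu : ∀ k, subScalar T z (u k) = 0 := fun k => (u k).2
  obtain ⟨a, ha, φ, hφ, hlim⟩ := hp.exists_tendsto_ker hT hu1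
    (by simp only [hSu, tendsto_const_nhds])
  refine ⟨⟨a, ha⟩, ?_, φ, hφ, tendsto_subtype_rng.2 hlim⟩
  rw [mem_closedBall_zero_iff]
  exact le_of_tendsto' hlim.norm fun k => hu1 (φ k)

end IsProperAt

section SelfAdjoint

variable [CompleteSpace H] {w : ℂ}

theorem inner_apply_left_eq (hT : IsSelfAdjoint T) (x y : T.domain) :
    inner ℂ (T x) (y : H) = inner ℂ (x : H) (T y) := by
  have hadj := LinearPMap.adjoint_isFormalAdjoint hT.dense_domain
  rw [LinearPMap.isSelfAdjoint_def.1 hT] at hadj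
  exact hadj x y

theorem inner_eq_zero_of_subScalar_eq_zero (hT : IsSelfAdjoint T) {x y : T.domain}
    (hx : subScalar T z x = 0) (hy : subScalar T w y = 0) (hzw : starRingEnd ℂ z ≠ w) :
    inner ℂ (x : H) (y : H) = 0 := by
  have hxy := inner_apply_left_eq hT x y
  rw [subScalar_eq_zero_iff.1 hx, subScalar_eq_zero_iff.1 hy, inner_smul_left, inner_smul_right,
    ← sub_eq_zero, ← sub_mul] at hxy
  exact (mul_eq_zero.1 hxy).resolve_left (sub_ne_zero.2 hzw)

theorem conj_eq_of_mem_pointSpec (hT : IsSelfAdjoint T) (hz : z ∈ pointSpec T) :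
    starRingEnd ℂ z = z := by
  obtain ⟨x, hx0, hx⟩ := mem_pointSpec_iff.1 hz
  by_contra hne
  exact hx0 (Subtype.ext (inner_self_eq_zero.1 (inner_eq_zero_of_subScalar_eq_zero hT hx hx hne)))

theorem mem_graph_of_forall_inner_eq (hT : IsSelfAdjoint T) {v u : H}
    (h : ∀ x : T.domain, inner ℂ (T x) v = inner ℂ (x : H) u) : (v, u) ∈ T.graph := by
  have hadj := LinearPMap.adjoint_graph_eq_graph_adjoint hT.dense_domain
  rw [LinearPMap.isSelfAdjoint_def.1 hT] at hadj
  rw [hadj, Submodule.mem_adjoint_iff]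
  intro a b hab
  obtain ⟨x, rfl, rfl⟩ := T.mem_graph_iff.1 hab
  exact sub_eq_zero.2 (h x)

theorem dense_range_subScalar (hT : IsSelfAdjoint T) (hz : z ∉ pointSpec T) :
    Dense (LinearMap.range (subScalar T z) : Set H) := by
  rw [Submodule.dense_iff_topologicalClosure_eq_top, Submodule.topologicalClosure_eq_top_iff,
    Submodule.eq_bot_iff]
  intro v hv
  have hgraph : (v, starRingEnd ℂ z • v) ∈ T.graph := by
    refine mem_graph_of_forall_inner_eq hT fun x => ?_
    have hx := (Submodule.mem_orthogonal _ v).1 hv _ ⟨x, rfl⟩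
    rwa [subScalar_apply, inner_sub_left, inner_smul_left, ← inner_smul_right, sub_eq_zero] at hx
  obtain ⟨y, rfl, hy⟩ := T.mem_graph_iff.1 hgraph
  by_contra hy0
  have hconj : starRingEnd ℂ z ∈ pointSpec T :=
    mem_pointSpec_iff.2 ⟨y, fun h => hy0 (congrArg Subtype.val h), subScalar_eq_zero_iff.2 hy⟩
  have hreal := conj_eq_of_mem_pointSpec hT hconj
  rw [Complex.conj_conj] at hreal
  exact hz (hreal ▸ hconj)

theorem mem_contSpec (hT : IsSelfAdjoint T) (hz : z ∈ spec T) (hz' : z ∉ pointSpec T) :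
    z ∈ contSpec T := by
  refine ⟨hz, not_not.1 hz', ?_⟩
  have hdense := dense_range_subScalar hT hz'
  rwa [LinearMap.coe_range] at hdense

theorem mem_resolventSet_of_antilipschitzWith (hT : IsSelfAdjoint T) (hz : z ∉ pointSpec T)
    {C : ℝ≥0} (hC : AntilipschitzWith C (subScalar T z)) : z ∈ resolventSet T := by
  have hsurj : Function.Surjective (subScalar T z) := by
    rw [← LinearMap.range_eq_top, ← SetLike.coe_set_eq, Submodule.top_coe,
      ← (isClosed_range_subScalar hT.isClosed hC).closure_eq]
    exact (dense_range_subScalar hT hz).closure_eq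
  let S := LinearEquiv.ofBijective (subScalar T z) ⟨hC.injective, hsurj⟩
  have hS : ∀ y, subScalar T z (S.symm y) = y := S.apply_symm_apply
  have hbound : ∀ y, ‖S.symm y‖ ≤ C * ‖y‖ := fun y => by
    simpa only [hS] using ZeroHomClass.bound_of_antilipschitz (subScalar T z) hC (S.symm y)
  exact ⟨(T.domain.subtype ∘ₗ S.symm.toLinearMap).mkContinuous C hbound,
    fun y => ⟨(S.symm y).2, hS y⟩, fun x => congrArg Subtype.val (S.symm_apply_apply x)⟩

namespace IsProperAt

theorem mem_pointSpec_of_mem_spec (hp : IsProperAt T z) (hT : IsSelfAdjoint T)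
    (hz : z ∈ spec T) : z ∈ pointSpec T := by
  by_contra hz'
  obtain ⟨C, hC⟩ := hp.exists_antilipschitzWith hT.isClosed hz'
  exact hz (mem_resolventSet_of_antilipschitzWith hT hz' hC)

theorem eventually_notMem_pointSpec (hp : IsProperAt T z) (hT : IsSelfAdjoint T) :
    ∀ᶠ w in 𝓝[≠] z, w ∉ pointSpec T := by
  by_contra hcon
  obtain ⟨w, hw, hmem⟩ := exists_seq_forall_of_frequently (not_eventually.1 hcon)
  obtain ⟨hwz, hne⟩ := tendsto_nhdsWithin_iff.1 hw
  choose x hx hSx using fun k => exists_unit_eigenvector (not_not.1 (hmem k))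
  have hlim : Tendsto (fun k => subScalar T z (x k)) atTop (𝓝 0) := by
    have hnorm : ∀ k, ‖subScalar T z (x k)‖ = ‖w k - z‖ := fun k => by
      rw [subScalar_apply, subScalar_eq_zero_iff.1 (hSx k), ← sub_smul, norm_smul,
        ← Submodule.coe_norm, hx, mul_one]
    rw [tendsto_zero_iff_norm_tendsto_zero]
    simpa only [hnorm] using tendsto_iff_norm_sub_tendsto_zero.1 hwz
  obtain ⟨a, ha, φ, hφ, hxa⟩ := hp.exists_tendsto_ker hT.isClosed (fun k => (hx k).le) hlim
  have horth : ∀ᶠ k in atTop, inner ℂ (x (φ k)) a = 0 :=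
    (hφ.tendsto_atTop.eventually hne).mono fun k hk =>
      inner_eq_zero_of_subScalar_eq_zero hT (hSx (φ k)) ha
        (by rwa [conj_eq_of_mem_pointSpec hT (not_not.1 (hmem (φ k)))])
  have ha0 : inner ℂ a a = 0 := tendsto_nhds_unique (hxa.inner tendsto_const_nhds)
    (tendsto_const_nhds.congr' (horth.mono fun k hk => hk.symm))
  have ha1 : ‖a‖ = 1 := tendsto_nhds_unique hxa.norm (by simp only [hx, tendsto_const_nhds])
  rw [inner_self_eq_zero.1 ha0, norm_zero] at ha1
  exact zero_ne_one ha1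

end IsProperAt

theorem mem_discreteSpec_of_eventually_isProperAt (hT : IsSelfAdjoint T) (hz : z ∈ spec T)
    (hp : ∀ᶠ w in 𝓝 z, IsProperAt T w) : z ∈ discreteSpec T := by
  have hpz := hp.self_of_nhds
  have hiso : ∀ᶠ w in 𝓝 z, w ∈ spec T → w = z := by
    filter_upwards [hp, eventually_nhdsWithin_iff.1 (hpz.eventually_notMem_pointSpec hT)]
      with w hpw hw hspec
    by_contra hne
    exact hw hne (hpw.mem_pointSpec_of_mem_spec hT hspec)
  obtain ⟨ε, hε, hball⟩ := Metric.eventually_nhds_iff.1 hiso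
  exact ⟨hpz.mem_pointSpec_of_mem_spec hT hz, hpz.finiteDimensional_eigenspace hT.isClosed,
    ε, hε, fun w hw hdist => hball hdist hw⟩

end SelfAdjoint

end UnboundedOperator

namespace SequenceSpace

section Compactness

variable {ι : Type*} {E : ι → Type*} [∀ i, NormedAddCommGroup (E i)] {p : ℝ≥0∞} [Fact (1 ≤ p)]
  {g : ι → ℝ}

theorem tendsto_of_dominated {α : Type*} {l : Filter α} (hp : p ≠ ∞) (hg : Memℓp g p)
    {F : α → lp E p} {f : lp E p} (hF : ∀ᶠ a in l, ∀ i, ‖F a i‖ ≤ g i)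
    (hlim : ∀ i, Tendsto (fun a => F a i) l (𝓝 (f i))) : Tendsto F l (𝓝 f) := by
  have hp0 : 0 < p.toReal := ENNReal.toReal_pos (one_pos.trans_le Fact.out).ne' hp
  have hsum : Summable fun i => ‖g i + ‖f i‖‖ ^ p.toReal :=
    (hg.add (memℓp_norm_iff.2 (lp.memℓp f))).summable hp0
  have hpow : Tendsto (fun a => ‖F a - f‖ ^ p.toReal) l (𝓝 0) := by
    simp only [lp.norm_rpow_eq_tsum hp0, lp.coeFn_sub, Pi.sub_apply]
    rw [← tsum_zero (L := .unconditional ι)]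
    refine tendsto_tsum_of_dominated_convergence hsum (fun i => ?_) ?_
    · have hi := (tendsto_iff_norm_sub_tendsto_zero.1 (hlim i)).rpow_const (.inr hp0.le)
      rwa [Real.zero_rpow hp0.ne'] at hi
    · filter_upwards [hF] with a ha i
      have hle : ‖F a i - f i‖ ≤ ‖g i + ‖f i‖‖ := calc
        ‖F a i - f i‖ ≤ ‖F a i‖ + ‖f i‖ := norm_sub_le _ _
        _ ≤ g i + ‖f i‖ := by gcongr; exact ha i
        _ ≤ ‖g i + ‖f i‖‖ := le_abs_self _
      rw [Real.norm_of_nonneg (by positivity)]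
      exact Real.rpow_le_rpow (norm_nonneg _) hle hp0.le
  rw [tendsto_iff_norm_sub_tendsto_zero]
  have hroot := hpow.rpow_const (p := p.toReal⁻¹) (.inr (by positivity))
  simpa only [Real.rpow_rpow_inv (norm_nonneg _) hp0.ne', Real.zero_rpow (inv_ne_zero hp0.ne')]
    using hroot

theorem isCompact_setOf_norm_apply_le [∀ i, ProperSpace (E i)] (hp : p ≠ ∞) (hg : Memℓp g p) :
    IsCompact {u : lp E p | ∀ i, ‖u i‖ ≤ g i} := by
  rw [isCompact_iff_ultrafilter_le_nhds]
  intro U hU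
  have hcube : ∀ᶠ u in (U : Filter (lp E p)), ∀ i, ‖u i‖ ≤ g i := le_principal_iff.1 hU
  have hcoord : ∀ i, ∃ y ∈ Metric.closedBall (0 : E i) (g i),
      Tendsto (fun u : lp E p => u i) U (𝓝 y) := fun i =>
    (isCompact_closedBall 0 (g i)).ultrafilter_le_nhds (U.map fun u => u i)
      (tendsto_principal.2 (hcube.mono fun u hu => mem_closedBall_zero_iff.2 (hu i)))
  choose y hy hlim using hcoord
  have hyg : ∀ i, ‖y i‖ ≤ g i := fun i => mem_closedBall_zero_iff.1 (hy i)
  exact ⟨⟨y, hg.mono hyg⟩, hyg, tendsto_of_dominated hp hg hcube hlim⟩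

end Compactness

theorem memℓp_mul_pow_natAbs {p : ℝ≥0∞} [Fact (1 ≤ p)] (D : ℝ) {r : ℝ} (hr : |r| < 1) :
    Memℓp (fun n : ℤ => D * r ^ n.natAbs) p := by
  suffices hone : Memℓp (fun n : ℤ => r ^ n.natAbs) 1 from
    (hone.of_exponent_ge Fact.out).const_mul D
  refine memℓp_gen ?_
  have hgeom : Summable fun n : ℕ => |r| ^ n := summable_geometric_of_lt_one (abs_nonneg r) hr
  simpa using Summable.of_nat_of_neg (f := fun n : ℤ => |r| ^ n.natAbs)
    (by simpa using hgeom) (by simpa using hgeom)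

section Operators

variable {𝕜 ι κ E : Type*} [NormedField 𝕜] [NormedAddCommGroup E] [NormedSpace 𝕜 E]
  {p : ℝ≥0∞}

section Reindex

variable [Fact (1 ≤ p)]

theorem memℓp_comp_equiv (σ : ι ≃ κ) {x : κ → E} (hx : Memℓp x p) : Memℓp (x ∘ σ) p := by
  obtain rfl | hp := p.dichotomy
  · refine memℓp_infty ?_
    obtain ⟨C, hC⟩ := memℓp_infty_iff.1 hx
    exact ⟨C, Set.forall_mem_range.2 fun i => hC ⟨σ i, rfl⟩⟩
  · exact memℓp_gen ((hx.summable (one_pos.trans_le hp)).comp_injective σ.injective)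

variable (𝕜 E p) in
/-- Composition of sequences with a bijection of the index sets, as an isometry of `ℓᵖ` spaces. -/
def reindex (σ : ι ≃ κ) : lp (fun _ : κ => E) p →ₗᵢ[𝕜] lp (fun _ : ι => E) p where
  toFun x := ⟨x ∘ σ, memℓp_comp_equiv σ (lp.memℓp x)⟩
  map_add' _ _ := rfl
  map_smul' _ _ := rfl
  norm_map' x := by
    obtain rfl | hp := p.dichotomy
    · exact σ.iSup_comp (g := fun k => ‖x k‖)
    · simp only [lp.norm_eq_tsum_rpow (one_pos.trans_le hp)]
      exact congrArg (· ^ (1 / p.toReal)) (σ.tsum_eq fun k => ‖x k‖ ^ p.toReal)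

end Reindex

variable (𝕜) in
/-- The coordinate projection of `ℓᵖ` onto the sequences supported in `s`. -/
def cutoff (s : Set ι) : lp (fun _ : ι => E) p →ₗ[𝕜] lp (fun _ : ι => E) p where
  toFun x := ⟨s.indicator x, (lp.memℓp x).mono' fun i => norm_indicator_le_norm_self x i⟩
  map_add' x y := lp.ext (Set.indicator_add s x y)
  map_smul' c x := lp.ext (Set.indicator_const_smul s c x)

theorem cutoff_apply (s : Set ι) (x : lp (fun _ : ι => E) p) :
    ⇑(cutoff 𝕜 s x) = s.indicator x := rfl

theorem norm_cutoff_le (hp : p ≠ 0) (s : Set ι) (x : lp (fun _ : ι => E) p) :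
    ‖cutoff 𝕜 s x‖ ≤ ‖x‖ :=
  lp.norm_mono hp fun i => norm_indicator_le_norm_self x i

theorem cutoff_add_cutoff_compl (s : Set ι) (x : lp (fun _ : ι => E) p) :
    cutoff 𝕜 s x + cutoff 𝕜 sᶜ x = x :=
  lp.ext (Set.indicator_self_add_compl s x)

theorem cutoff_congr {s : Set ι} {x y : lp (fun _ : ι => E) p} (h : Set.EqOn x y s) :
    cutoff 𝕜 s x = cutoff 𝕜 s y :=
  lp.ext (Set.indicator_congr h)

end Operators

end SequenceSpace

namespace JacobiA

open UnboundedOperator SequenceSpace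

theorem norm_e (n : ℤ) : ‖e n‖ = 1 := by
  rw [e, lp.norm_single two_pos, norm_one]

theorem inner_e_left (n : ℤ) (x : L2Z) : inner ℂ (e n) x = x n := by
  rw [e, lp.inner_single_left, RCLike.inner_apply, map_one, mul_one]

section Laurent

variable (q : ℝ) (x : L2Z)

/-- The operator `U + q U⁻¹` on `ℓ²(ℤ)`, where `U` is the bilateral shift `(U x) n = x (n + 1)`. Its
`n`-th row is `q ^ n` times the `n`-th row of the Jacobi matrix `A q`. -/
def laurent : L2Z →ₗ[ℂ] L2Z :=
  (reindex ℂ ℂ 2 (Equiv.addRight (1 : ℤ))).toLinearMap +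
    (q : ℂ) • (reindex ℂ ℂ 2 (Equiv.subRight (1 : ℤ))).toLinearMap

theorem laurent_apply (n : ℤ) : laurent q x n = x (n + 1) + q * x (n - 1) := rfl

theorem norm_laurent_le : ‖laurent q x‖ ≤ (1 + |q|) * ‖x‖ := by
  refine (norm_add_le _ _).trans_eq ?_
  rw [LinearMap.smul_apply, norm_smul, Complex.norm_real, Real.norm_eq_abs, add_mul, one_mul]
  simp only [LinearIsometry.coe_toLinearMap, LinearIsometry.norm_map]

theorem le_norm_laurent : (1 - |q|) * ‖x‖ ≤ ‖laurent q x‖ := by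
  refine Eq.trans_le ?_ (norm_sub_le_norm_add _ _)
  rw [LinearMap.smul_apply, norm_smul, Complex.norm_real, Real.norm_eq_abs, sub_mul, one_mul]
  simp only [LinearIsometry.coe_toLinearMap, LinearIsometry.norm_map]

theorem cutoff_compl_Ici_laurent :
    cutoff ℂ (Set.Ici 0)ᶜ (laurent q x) =
      cutoff ℂ (Set.Ici 0)ᶜ (laurent q (cutoff ℂ (Set.Iic 0) x)) := by
  refine cutoff_congr fun n hn => ?_
  have hn0 : n < 0 := by simpa using hn
  have hsucc : n + 1 ∈ Set.Iic 0 := Set.mem_Iic.2 (by omega)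
  have hpred : n - 1 ∈ Set.Iic 0 := Set.mem_Iic.2 (by omega)
  rw [laurent_apply, laurent_apply, cutoff_apply, Set.indicator_of_mem hsucc,
    Set.indicator_of_mem hpred]

end Laurent

section Extension

variable {q : ℝ} {T : L2Z →ₗ.[ℂ] L2Z}

theorem extension_apply_e (hext : A q ≤ T) (n : ℤ) :
    T ⟨e n, hext.1 (e_mem_domain q n)⟩ =
      ((q : ℂ) ^ (-n + 1)) • e (n - 1) + ((q : ℂ) ^ (-n)) • e (n + 1) := by
  rw [← A_apply_e]
  exact (hext.2 rfl).symm

theorem extension_apply_apply (hext : A q ≤ T) (hsa : IsSelfAdjoint T) (x : T.domain) (n : ℤ) :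
    T x n = (q : ℂ) ^ (-n + 1) * (x : L2Z) (n - 1) + (q : ℂ) ^ (-n) * (x : L2Z) (n + 1) := by
  have hsymm := inner_apply_left_eq hsa ⟨e n, hext.1 (e_mem_domain q n)⟩ x
  rw [extension_apply_e hext, inner_add_left, inner_smul_left, inner_smul_left, inner_e_left,
    inner_e_left, inner_e_left] at hsymm
  simpa only [map_zpow₀, Complex.conj_ofReal] using hsymm.symm

theorem zpow_mul_extension_apply (hq0 : q ≠ 0) (hext : A q ≤ T) (hsa : IsSelfAdjoint T)
    (x : T.domain) (n : ℤ) : (q : ℂ) ^ n * T x n = laurent q x n := by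
  have hqc : (q : ℂ) ≠ 0 := Complex.ofReal_ne_zero.2 hq0
  rw [extension_apply_apply hext hsa, laurent_apply, zpow_add₀ hqc, zpow_neg, zpow_one]
  field_simp
  ring

theorem zero_notMem_pointSpec (hq0 : q ≠ 0) (hq1 : |q| < 1) (hext : A q ≤ T)
    (hsa : IsSelfAdjoint T) : (0 : ℂ) ∉ pointSpec T := by
  rw [mem_pointSpec_iff]
  rintro ⟨x, hx0, hx⟩
  have hTx : T x = 0 := by rw [subScalar_eq_zero_iff.1 hx, zero_smul]
  have hlaurent : laurent q x = 0 := lp.ext <| funext fun n => by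
    rw [← zpow_mul_extension_apply hq0 hext hsa, hTx, lp.coeFn_zero, Pi.zero_apply, mul_zero]
  have hnorm := le_norm_laurent q x
  rw [hlaurent, norm_zero] at hnorm
  exact hnorm.not_gt (mul_pos (sub_pos.2 hq1) (norm_pos_iff.2 fun h => hx0 (Subtype.ext h)))

theorem zero_mem_spec (hq1 : |q| < 1) (hext : A q ≤ T) : (0 : ℂ) ∈ spec T := by
  refine mem_spec_of_tendsto_zero
    (x := fun k : ℕ => ⟨e (-k), hext.1 (e_mem_domain q (-k))⟩) (fun k => norm_e (-k)) ?_
  have hpow : Tendsto (fun k : ℕ => |q| ^ k) atTop (𝓝 0) :=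
    tendsto_pow_atTop_nhds_zero_of_lt_one (abs_nonneg q) hq1
  refine squeeze_zero_norm (fun k => ?_)
    (by simpa using (hpow.comp (tendsto_add_atTop_nat 1)).add hpow)
  rw [subScalar_apply, zero_smul, sub_zero, extension_apply_e hext]
  refine (norm_add_le _ _).trans_eq ?_
  simp only [norm_smul, norm_e, mul_one, norm_zpow, Complex.norm_real, Real.norm_eq_abs, neg_neg]
  norm_cast

/-- The operator which acts as `laurent q` in the coordinates `n ≥ 0` and as `T` in the coordinates
`n < 0`. -/
def glued (q : ℝ) (T : L2Z →ₗ.[ℂ] L2Z) : T.domain →ₗ[ℂ] L2Z :=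
  cutoff ℂ (Set.Ici 0) ∘ₗ laurent q ∘ₗ T.domain.subtype + cutoff ℂ (Set.Ici 0)ᶜ ∘ₗ T.toFun

theorem glued_apply (x : T.domain) (n : ℤ) :
    glued q T x n = (Set.Ici 0).indicator (laurent q x) n + (Set.Ici 0)ᶜ.indicator (T x) n := rfl

theorem glued_apply_of_nonneg {n : ℤ} (hn : 0 ≤ n) (x : T.domain) :
    glued q T x n = laurent q x n := by
  rw [glued_apply, Set.indicator_of_mem (Set.mem_Ici.2 hn),
    Set.indicator_of_notMem (Set.notMem_compl_iff.2 (Set.mem_Ici.2 hn)), add_zero]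

theorem glued_apply_of_neg {n : ℤ} (hn : n < 0) (x : T.domain) : glued q T x n = T x n := by
  rw [glued_apply, Set.indicator_of_notMem (Set.notMem_Ici.2 hn),
    Set.indicator_of_mem (Set.mem_compl (Set.notMem_Ici.2 hn)), zero_add]

theorem glued_apply_of_nonpos (hq0 : q ≠ 0) (hext : A q ≤ T) (hsa : IsSelfAdjoint T) {n : ℤ}
    (hn : n ≤ 0) (x : T.domain) : glued q T x n = T x n := by
  obtain hn | rfl := hn.lt_or_eq
  · exact glued_apply_of_neg hn x
  · rw [glued_apply_of_nonneg le_rfl, ← zpow_mul_extension_apply hq0 hext hsa, zpow_zero, one_mul]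

theorem norm_glued_apply_le (hq0 : q ≠ 0) (hext : A q ≤ T) (hsa : IsSelfAdjoint T)
    (x : T.domain) (n : ℤ) :
    ‖glued q T x n‖ ≤ max ‖laurent q x‖ ‖T x‖ * |q| ^ n.natAbs := by
  have hweight := zpow_mul_extension_apply hq0 hext hsa x n
  obtain hn | hn := le_or_gt 0 n
  · lift n to ℕ using hn
    rw [glued_apply_of_nonneg (Int.natCast_nonneg n), ← hweight, norm_mul, norm_zpow, mul_comm]
    simp only [Complex.norm_real, Real.norm_eq_abs, zpow_natCast, Int.natAbs_natCast]
    gcongr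
    exact (lp.norm_apply_le_norm two_ne_zero _ _).trans (le_max_right _ _)
  · obtain ⟨k, rfl⟩ : ∃ k : ℕ, n = -k := ⟨n.natAbs, by omega⟩
    have hqc : (q : ℂ) ^ k ≠ 0 := pow_ne_zero k (Complex.ofReal_ne_zero.2 hq0)
    rw [zpow_neg, zpow_natCast, inv_mul_eq_iff_eq_mul₀ hqc] at hweight
    rw [glued_apply_of_neg hn, hweight, norm_mul, norm_pow, mul_comm]
    simp only [Complex.norm_real, Real.norm_eq_abs, Int.natAbs_neg, Int.natAbs_natCast]
    gcongr
    exact (lp.norm_apply_le_norm two_ne_zero _ _).trans (le_max_left _ _)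

theorem isRelativelyCompact_glued (hq0 : q ≠ 0) (hq1 : |q| < 1) (hext : A q ≤ T)
    (hsa : IsSelfAdjoint T) : IsRelativelyCompact T (glued q T) := by
  intro M
  have hdecay : Memℓp (fun n : ℤ => max ((1 + |q|) * M) M * |q| ^ n.natAbs) 2 :=
    memℓp_mul_pow_natAbs _ (by rwa [abs_abs])
  refine ⟨_, isCompact_setOf_norm_apply_le ENNReal.ofNat_ne_top hdecay, fun x hx hTx n => ?_⟩
  refine (norm_glued_apply_le hq0 hext hsa x n).trans ?_
  have hlaurent : ‖laurent q x‖ ≤ (1 + |q|) * M :=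
    (norm_laurent_le q x).trans (mul_le_mul_of_nonneg_left hx (by positivity))
  gcongr

theorem norm_mul_norm_cutoff_Iic_le (hq0 : q ≠ 0) (hext : A q ≤ T) (hsa : IsSelfAdjoint T) (z : ℂ)
    (x : T.domain) :
    ‖z‖ * ‖cutoff ℂ (Set.Iic 0) (x : L2Z)‖ ≤ ‖glued q T x‖ + ‖subScalar T z x‖ := by
  have hcutoff : cutoff ℂ (Set.Iic 0) (glued q T x) = cutoff ℂ (Set.Iic 0) (T x) :=
    cutoff_congr fun n hn => glued_apply_of_nonpos hq0 hext hsa hn x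
  have hz : z • cutoff ℂ (Set.Iic 0) (x : L2Z) =
      cutoff ℂ (Set.Iic 0) (glued q T x - subScalar T z x) := by
    rw [subScalar_apply, map_sub, map_sub, map_smul, hcutoff, sub_sub_cancel]
  rw [← norm_smul, hz]
  exact (norm_cutoff_le two_ne_zero _ _).trans (norm_sub_le _ _)

theorem norm_laurent_le_glued_add (x : T.domain) :
    ‖laurent q x‖ ≤ ‖glued q T x‖ + (1 + |q|) * ‖cutoff ℂ (Set.Iic 0) (x : L2Z)‖ := by
  have hcutoff : cutoff ℂ (Set.Ici 0) (laurent q x) = cutoff ℂ (Set.Ici 0) (glued q T x) :=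
    cutoff_congr fun n hn => (glued_apply_of_nonneg hn x).symm
  rw [← cutoff_add_cutoff_compl (𝕜 := ℂ) (Set.Ici 0) (laurent q x), cutoff_compl_Ici_laurent,
    hcutoff]
  exact (norm_add_le _ _).trans (add_le_add (norm_cutoff_le two_ne_zero _ _)
    ((norm_cutoff_le two_ne_zero _ _).trans (norm_laurent_le q _)))

theorem exists_antilipschitzWith_glued_prod (hq0 : q ≠ 0) (hq1 : |q| < 1) (hext : A q ≤ T)
    (hsa : IsSelfAdjoint T) {z : ℂ} (hz : z ≠ 0) :
    ∃ C : ℝ≥0, AntilipschitzWith C ((glued q T).prod (subScalar T z)) := by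
  have hq : 0 < 1 - |q| := sub_pos.2 hq1
  have hz : 0 < ‖z‖ := norm_pos_iff.2 hz
  refine ⟨((1 + (1 + |q|) * (2 / ‖z‖)) / (1 - |q|)).toNNReal,
    AddMonoidHomClass.antilipschitz_of_bound _ fun x => ?_⟩
  rw [Real.coe_toNNReal _ (by positivity)]
  set m := ‖(glued q T).prod (subScalar T z) x‖
  have hglued : ‖glued q T x‖ ≤ m := le_max_left _ _
  have hsub : ‖subScalar T z x‖ ≤ m := le_max_right _ _
  have hcutoff : ‖cutoff ℂ (Set.Iic 0) (x : L2Z)‖ ≤ 2 / ‖z‖ * m := by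
    rw [div_mul_eq_mul_div, le_div_iff₀' hz]
    linarith [norm_mul_norm_cutoff_Iic_le hq0 hext hsa z x]
  rw [div_mul_eq_mul_div, le_div_iff₀' hq]
  calc (1 - |q|) * ‖x‖ ≤ ‖laurent q x‖ := le_norm_laurent q x
    _ ≤ ‖glued q T x‖ + (1 + |q|) * ‖cutoff ℂ (Set.Iic 0) (x : L2Z)‖ := norm_laurent_le_glued_add x
    _ ≤ m + (1 + |q|) * (2 / ‖z‖ * m) := by gcongr
    _ = (1 + (1 + |q|) * (2 / ‖z‖)) * m := by ring

theorem isProperAt_of_ne_zero (hq0 : q ≠ 0) (hq1 : |q| < 1) (hext : A q ≤ T)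
    (hsa : IsSelfAdjoint T) {z : ℂ} (hz : z ≠ 0) : IsProperAt T z := by
  obtain ⟨C, hC⟩ := exists_antilipschitzWith_glued_prod hq0 hq1 hext hsa hz
  exact isProperAt_of_antilipschitzWith_prod (isRelativelyCompact_glued hq0 hq1 hext hsa) hC

theorem essSpec_subset_zero (hq0 : q ≠ 0) (hq1 : |q| < 1) (hext : A q ≤ T)
    (hsa : IsSelfAdjoint T) : essSpec T ⊆ {0} := by
  intro z hz
  by_contra hz0
  exact hz.2 <| mem_discreteSpec_of_eventually_isProperAt hsa hz.1 <|
    (isOpen_ne.eventually_mem hz0).mono fun w hw => isProperAt_of_ne_zero hq0 hq1 hext hsa hw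

end Extension

end JacobiA

end

theorem mainTheorem5_general (q : ℝ) (hq0 : q ≠ 0) (hq1 : |q| < 1)
    (T : JacobiA.L2Z →ₗ.[ℂ] JacobiA.L2Z) (hext : JacobiA.A q ≤ T) (hsa : IsSelfAdjoint T) :
    UnboundedOperator.essSpec T = {0} ∧
    UnboundedOperator.contSpec T = {0} ∧
    (0 : ℂ) ∉ UnboundedOperator.pointSpec T := by
  have hpoint := JacobiA.zero_notMem_pointSpec hq0 hq1 hext hsa
  have hcont : {0} ⊆ UnboundedOperator.contSpec T := Set.singleton_subset_iff.2 <|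
    UnboundedOperator.mem_contSpec hsa (JacobiA.zero_mem_spec hq1 hext) hpoint
  have hess := JacobiA.essSpec_subset_zero hq0 hq1 hext hsa
  have hcontess := UnboundedOperator.contSpec_subset_essSpec T
  exact ⟨hess.antisymm (hcont.trans hcontess), (hcontess.trans hess).antisymm hcont, hpoint⟩

theorem mainTheorem5 (q : ℝ) (hq0 : 0 < q) (hq1 : q < 1)
    (T : JacobiA.L2Z →ₗ.[ℂ] JacobiA.L2Z) (hext : JacobiA.A q ≤ T) (hsa : IsSelfAdjoint T) :
    UnboundedOperator.essSpec T = {0} ∧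
    UnboundedOperator.contSpec T = {0} ∧
    (0 : ℂ) ∉ UnboundedOperator.pointSpec T :=
  mainTheorem5_general q hq0.ne' (by rwa [abs_of_pos hq0]) T hext hsa
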